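/- Let $g$ be a non-constant meromorphic function in $\mathbb{C}$ of order zero, that is, $$\limsup_{r\to\infty}\frac{\log^{+}T(r,g)}{\log r}=0,$$ where $m(r,g)=\frac1{2\pi}\int_0^{2\pi}\log^{+}|g(re^{i\theta})|\,d\theta$ is the Nevanlinna proximity function, $N(r,g)$ is the integrated counting function of the poles of $g$ (with multiplicity), and $T(r,g)=m(r,g)+N(r,g)$ is the Nevanlinna characteristic. Let $q,c\in\mathbb{C}$ with $0<|q|<1$, and let $$\mathcal{D}_{q,c}g(z)=\frac{g(qz+c)-g(z)}{(q-1)z+c},\qquad \mathcal{D}^{k}_{q,c}g=\mathcal{D}_{q,c}\big(\mathcal{D}^{k-1}_{q,c}g\big)\quad(k\ge 1),\qquad \mathcal{D}^{0}_{q,c}g=g .$$ Then there is a measurable set $E\subset(0,\infty)$ of logarithmic density $1$, that is, $$\lim_{r\to\infty}\frac1{\log r}\int_{E\cap[1,r]}\frac{dt}{t}=1,$$ such that $$m\!\left(r,\frac{\mathcal{D}_{q,c}g}{g}\right)=o(T(r,g))\qquad\text{and}\qquad m\!\left(r,\frac{\mathcal{D}^{k}_{q,c}g}{g}\right)=o(T(r,g))\quad\text{for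 every integer }k\ge 1,$$ as $r\to\infty$ with $r\in E$. (The set $E$ may depend on $g,q,c$ but not on $k$; the $o(\cdot)$ is for each fixed $k$.) -/

import Mathlib

open Filter Asymptotics
open scoped Filter

noncomputable section

/-- The Hahn difference operator `𝓓_{q,c} g (z) = (g (q z + c) - g z) / ((q - 1) z + c)`. Its value
at the single point where the denominator vanishes, and at the discrete set of points where `g` has
a pole at `z` or at `q z + c`, is immaterial for the proximity function. -/
def hahnDifference (q c : ℂ) (g : ℂ → ℂ) (z : ℂ) : ℂ :=
  (g (q * z + c) - g z) / ((q - 1) * z + c)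

/-- The `k`-th order Hahn difference operator, `𝓓^k g = 𝓓 (𝓓^(k-1) g)`. -/
def iteratedHahnDifference (q c : ℂ) : ℕ → (ℂ → ℂ) → ℂ → ℂ
  | 0, g => g
  | k + 1, g => hahnDifference q c (iteratedHahnDifference q c k g)

/-- The Nevanlinna proximity function `m(r, f) = (2π)⁻¹ ∫₀^{2π} log⁺ |f (r e^{iθ})| dθ`. -/
abbrev nevanlinnaM (f : ℂ → ℂ) (r : ℝ) : ℝ := ValueDistribution.proximity f ⊤ r

/-- The Nevanlinna characteristic `T(r, f) = m(r, f) + N(r, f)`. -/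
abbrev nevanlinnaT (f : ℂ → ℂ) (r : ℝ) : ℝ := ValueDistribution.characteristic f ⊤ r

/-- The order of growth `limsup_{r → ∞} log⁺ T(r, g) / log r`, as an extended real number. -/
def growthOrder (g : ℂ → ℂ) : EReal :=
  limsup (fun r : ℝ => ((Real.posLog (nevanlinnaT g r) / Real.log r : ℝ) : EReal)) atTop

/-- A meromorphic function is given here by a total function `ℂ → ℂ` whose values on a discrete
closed set are immaterial; it is constant if it agrees with a constant off such a set. -/
def IsConstantMeromorphic (g : ℂ → ℂ) : Prop :=
  ∃ a : ℂ, g =ᶠ[codiscrete ℂ] fun _ => a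

/-- A measurable set `E ⊆ (0, ∞)` has logarithmic density one if
`(log r)⁻¹ ∫_{E ∩ [1, r]} dt / t → 1` as `r → ∞`. -/
def HasLogDensityOne (E : Set ℝ) : Prop :=
  E ⊆ Set.Ioi 0 ∧ MeasurableSet E ∧
    Tendsto (fun r : ℝ => (∫ t in E ∩ Set.Icc 1 r, t⁻¹) / Real.log r) atTop (nhds 1)

end

/-! ### Circle means of linear factors, and oscillation of harmonic functions. -/

section CircleAverage

open Real MeasureTheory Metric

/-! Far from the origin the denominator of the Hahn operator has modulus at least `1`, so `|𝓓^k g|`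
is at most a constant times the sum of `|g|` over the iterates of `z ↦ qz + c`. These iterates are
affine with multiplier `q^j`, so it suffices that `m(r, g(Qz + b)/g) = o(T(r, g))` whenever `0 < |Q|
≤ 1`, on a set `E` depending on `g` alone.

On the disc of radius `R = Kr`, `log |g|` is a sum of terms `± log |z - u|` over zeros and poles
plus a harmonic function. Comparing the values at `Qz + b` and `z`, each linear factor costs a mean
error bounded uniformly in `u` (`circleAverage_abs_log_norm_affine_sub_sub_log_norm_sub_le`), and
the harmonic part oscillates by `O(1/K)` times its mean modulus (`abs_sub_le_of_harmonicOnNhd`). The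
number `n` of zeros and poles satisfies `n log K ≤ 2T(K²r) + O(1)`. Hence where `T(Kr)` and `T(K²r)`
are at most `2T(r)` and `T(r)` is large, the whole is `O(T(r)/log K)`.

Order zero makes these doubling bounds hold, for each fixed `K`, off a set of logarithmic density
zero; a diagonal choice over integers `K` gives one set `E`. Letting `K` grow gives `o(T)`. -/

theorem circleAverage_mono_of_countable {f g : ℂ → ℝ} {c : ℂ} {r : ℝ} {B : Set ℂ}
    (hr : r ≠ 0) (hB : B.Countable) (hf : ∀ z, 0 ≤ f z) (hg : CircleIntegrable g c r)
    (hfg : ∀ z ∈ sphere c |r|, z ∉ B → f z ≤ g z) :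
    circleAverage f c r ≤ circleAverage g c r := by
  rw [circleAverage_def, circleAverage_def, smul_eq_mul, smul_eq_mul]
  refine mul_le_mul_of_nonneg_left ?_ (by positivity)
  rw [intervalIntegral.integral_of_le two_pi_pos.le, intervalIntegral.integral_of_le two_pi_pos.le]
  -- Only the majorant has to be integrable: the integral of a non-integrable `f` is `0` by
  -- convention.
  refine integral_mono_of_nonneg (ae_of_all _ fun θ => hf _)
    ((intervalIntegrable_iff_integrableOn_Ioc_of_le two_pi_pos.le).1 hg) ?_
  have h0 : volume (circleMap c r ⁻¹' B) = 0 := (hB.preimage_circleMap c hr).measure_zero _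
  refine ae_restrict_of_ae ?_
  filter_upwards [measure_eq_zero_iff_ae_notMem.1 h0] with θ hθ
  exact hfg _ (circleMap_mem_sphere' c r θ) hθ

theorem circleIntegrable_log_norm_affine_sub (q c u : ℂ) (r : ℝ) :
    CircleIntegrable (fun z => log ‖q * z + c - u‖) 0 r :=
  MeromorphicOn.circleIntegrable_log_norm (f := fun z => q * z + c - u)
    (fun z _ => by fun_prop)

/-- By Jensen the difference inside has mean zero, and it is at most `log 2`. A function `a ≤ log 2`
satisfies `|a| ≤ 2 log 2 - a`, whose mean is then `2 log 2`. -/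
theorem circleAverage_abs_log_norm_sub_sub_log_max_le {r : ℝ} (hr : 1 ≤ r) (v : ℂ) :
    circleAverage (fun z => |log ‖z - v‖ - log (max r ‖v‖)|) 0 r ≤ 2 * log 2 := by
  have hr0 : 0 < r := by linarith
  set A := max r ‖v‖ with hA
  have hA1 : 1 ≤ A := hr.trans (le_max_left _ _)
  have hi : CircleIntegrable (fun z => log ‖z - v‖) 0 r := circleIntegrable_log_norm_sub_const r
  have havg : circleAverage (fun z => log ‖z - v‖) 0 r = log A := by
    rw [circleAverage_log_norm_sub_const_eq_log_radius_add_posLog hr0.ne',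
      posLog_eq_log_max_one (by positivity), ← log_mul hr0.ne' (by positivity), zero_sub, norm_neg,
      mul_max_of_nonneg _ _ hr0.le, mul_one, mul_inv_cancel_left₀ hr0.ne']
  have hi2 : CircleIntegrable (fun z => (2 * log 2 + log A) - log ‖z - v‖) 0 r :=
    (circleIntegrable_const _ _ _).sub hi
  calc circleAverage (fun z => |log ‖z - v‖ - log A|) 0 r
      ≤ circleAverage (fun z => (2 * log 2 + log A) - log ‖z - v‖) 0 r := by
        refine circleAverage_mono (hi.sub (circleIntegrable_const _ _ _)).abs hi2 fun z hz => ?_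
        have hz' : ‖z‖ = r := by simpa [abs_of_pos hr0] using hz
        have hle : log ‖z - v‖ ≤ log 2 + log A := by
          rcases eq_or_ne z v with rfl | hne
          · simp only [sub_self, norm_zero, log_zero]
            exact add_nonneg (log_nonneg one_le_two) (log_nonneg hA1)
          · rw [← log_mul two_ne_zero (by positivity)]
            refine log_le_log (norm_pos_iff.2 (sub_ne_zero.2 hne)) ((norm_sub_le _ _).trans ?_)
            have h1 : r ≤ A := le_max_left _ _
            have h2 : ‖v‖ ≤ A := le_max_right _ _
            linarith
        have : 0 ≤ log 2 := log_nonneg one_le_two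
        rcases abs_cases (log ‖z - v‖ - log A) with h | h <;> linarith
    _ = 2 * log 2 := by
        rw [circleAverage_fun_sub (circleIntegrable_const _ _ _) hi, circleAverage_const, havg]
        ring

/-- The two Jensen means, of `log |qz + c - u|` and of `log |z - u|`, differ by a bounded amount
uniformly in `u`, since `max (|q| r) |u - c|` and `max r |u|` are comparable. -/
theorem abs_log_norm_add_log_max_sub_log_max_le {q c u : ℂ} {r : ℝ} (hq0 : 0 < ‖q‖)
    (hq1 : ‖q‖ ≤ 1) (hr : 1 ≤ r) (hc : 2 * ‖c‖ ≤ r) :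
    |log ‖q‖ + log (max r ‖(u - c) / q‖) - log (max r ‖u‖)| ≤ log (2 / ‖q‖) := by
  have hr0 : 0 < r := by linarith
  have hX : 0 < max r ‖(u - c) / q‖ := lt_max_of_lt_left hr0
  have hY : 0 < max r ‖u‖ := lt_max_of_lt_left hr0
  rw [← log_mul hq0.ne' hX.ne', ← log_div (by positivity) hY.ne', mul_max_of_nonneg _ _ hq0.le,
    norm_div, mul_div_cancel₀ _ hq0.ne']
  set Y := max r ‖u‖ with hYdef
  have h1 : r ≤ Y := le_max_left _ _
  have h2 : ‖u‖ ≤ Y := le_max_right _ _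
  have hXpos : 0 < max (‖q‖ * r) ‖u - c‖ := lt_max_of_lt_left (by positivity)
  rw [abs_le, ← log_inv, inv_div]
  constructor
  · refine log_le_log (by positivity) ?_
    rw [div_le_div_iff₀ two_pos hY]
    rcases max_cases r ‖u‖ with ⟨h, -⟩ | ⟨h, h'⟩
    · have := le_max_left (‖q‖ * r) ‖u - c‖
      rw [hYdef, h]
      nlinarith
    · have h3 := le_max_right (‖q‖ * r) ‖u - c‖
      have h4 := norm_sub_norm_le u c
      rw [hYdef, h]
      nlinarith
  · refine log_le_log (by positivity) ?_
    rw [div_le_div_iff₀ hY hq0]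
    have h3 : max (‖q‖ * r) ‖u - c‖ ≤ 2 * Y := by
      refine max_le (by nlinarith) ((norm_sub_le _ _).trans ?_)
      linarith
    nlinarith

theorem circleAverage_abs_log_norm_affine_sub_sub_log_norm_sub_le {q c : ℂ} {r : ℝ}
    (hq0 : 0 < ‖q‖) (hq1 : ‖q‖ ≤ 1) (hr : 1 ≤ r) (hc : 2 * ‖c‖ ≤ r) (u : ℂ) :
    circleAverage (fun z => |log ‖q * z + c - u‖ - log ‖z - u‖|) 0 r
      ≤ 4 * log 2 + log (2 / ‖q‖) := by
  have hq : q ≠ 0 := norm_pos_iff.1 hq0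
  set v := (u - c) / q with hv
  have hi (a : ℂ) : CircleIntegrable (fun z => |log ‖z - a‖ - log (max r ‖a‖)|) 0 r :=
    ((circleIntegrable_log_norm_sub_const r).sub (circleIntegrable_const _ _ _)).abs
  calc circleAverage (fun z => |log ‖q * z + c - u‖ - log ‖z - u‖|) 0 r
      ≤ circleAverage (fun z => (|log ‖z - v‖ - log (max r ‖v‖)|
          + |log ‖z - u‖ - log (max r ‖u‖)|) + log (2 / ‖q‖)) 0 r := by
        refine circleAverage_mono_of_countable (by linarith) (Set.countable_singleton v)
          (fun z => abs_nonneg _) (((hi v).add (hi u)).add (circleIntegrable_const _ _ _))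
          fun z _ hz => ?_
        have e : q * z + c - u = q * (z - v) := by rw [hv]; field_simp; ring
        have hzv : ‖z - v‖ ≠ 0 := norm_ne_zero_iff.2 (sub_ne_zero.2 hz)
        rw [e, norm_mul, log_mul hq0.ne' hzv]
        have h3 := abs_log_norm_add_log_max_sub_log_max_le (u := u) hq0 hq1 hr hc
        rw [← hv] at h3
        have e2 : log ‖q‖ + log ‖z - v‖ - log ‖z - u‖ = (log ‖z - v‖ - log (max r ‖v‖))
          - (log ‖z - u‖ - log (max r ‖u‖))
          + (log ‖q‖ + log (max r ‖v‖) - log (max r ‖u‖)) := by ring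
        rw [e2]
        exact (abs_add_le _ _).trans (add_le_add (abs_sub _ _) h3)
    _ ≤ 4 * log 2 + log (2 / ‖q‖) := by
        rw [circleAverage_fun_add (by exact (hi v).add (hi u)) (circleIntegrable_const _ _ _),
          circleAverage_fun_add (hi v) (hi u), circleAverage_const]
        have h1 := circleAverage_abs_log_norm_sub_sub_log_max_le hr v
        have h2 := circleAverage_abs_log_norm_sub_sub_log_max_le hr u
        linarith

theorem abs_re_herglotzRieszKernel_sub_one_le {w z : ℂ} {R ρ : ℝ} (hw : ‖w‖ ≤ ρ) (hρ : 2 * ρ ≤ R)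
    (hR : 0 < R) (hz : z ∈ sphere (0 : ℂ) R) :
    |(herglotzRieszKernel 0 w z).re - 1| ≤ 4 * ρ / R := by
  have hρ0 : 0 ≤ ρ := (norm_nonneg w).trans hw
  have hwR : w ∈ ball (0 : ℂ) R := by
    rw [mem_ball_zero_iff]; linarith
  have h1 := re_herglotzRieszKernel_le hz hwR
  have h2 := le_re_herglotzRieszKernel hz hwR
  rw [herglotzRieszKernel_def]
  rw [sub_zero w] at *
  have h3 : 0 < R - ‖w‖ := by linarith
  have hn := norm_nonneg w
  have h5 : (R + ‖w‖) / (R - ‖w‖) ≤ 1 + 4 * ρ / R := by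
    rw [one_add_div hR.ne', div_le_div_iff₀ h3 hR]
    nlinarith
  have h6 : 1 - 4 * ρ / R ≤ (R - ‖w‖) / (R + ‖w‖) := by
    rw [one_sub_div hR.ne', div_le_div_iff₀ hR (by positivity)]
    nlinarith
  rw [abs_le]
  constructor <;> linarith

/-- Poisson's formula: the difference is the mean of `(P - 1) F`, and Harnack's bounds put the
kernel `P` within `4ρ/R` of `1`. -/
theorem abs_sub_circleAverage_le_of_harmonicOnNhd {F : ℂ → ℝ} {w : ℂ} {R ρ : ℝ}
    (hF : InnerProductSpace.HarmonicOnNhd F (closedBall 0 R)) (hw : ‖w‖ ≤ ρ) (hρ : 2 * ρ ≤ R)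
    (hR : 0 < R) :
    |F w - circleAverage F 0 R| ≤ 4 * ρ / R * circleAverage (fun z => |F z|) 0 R := by
  have hρ0 : 0 ≤ ρ := (norm_nonneg w).trans hw
  have hwR : w ∈ ball (0 : ℂ) R := by
    rw [mem_ball_zero_iff]; linarith
  have hFc : ContinuousOn F (sphere 0 |R|) := fun z hz =>
    (hF z (by rw [abs_of_pos hR] at hz; exact sphere_subset_closedBall hz)).1.continuousAt.continuousWithinAt
  have hFi : CircleIntegrable F 0 R := hFc.circleIntegrable'
  have hP : ContinuousOn (fun z => (herglotzRieszKernel 0 w z).re) (sphere 0 |R|) :=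
    Complex.continuous_re.comp_continuousOn (continuousOn_herglotzRieszKernel_sphere hwR)
  have hi : CircleIntegrable (fun z => (herglotzRieszKernel 0 w z).re * F z) 0 R :=
    (hP.mul hFc).circleIntegrable'
  have e : F w - circleAverage F 0 R
      = circleAverage (fun z => ((herglotzRieszKernel 0 w z).re - 1) * F z) 0 R := by
    have := hF.circleAverage_re_herglotzRieszKernel_smul hwR
    rw [← this, ← circleAverage_sub (by exact hi) hFi]
    congr 1
    ext z
    simp [sub_mul]
  rw [e]
  refine abs_circleAverage_le_circleAverage_abs.trans ?_
  rw [← smul_eq_mul (4 * ρ / R), ← circleAverage_fun_smul]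
  refine circleAverage_mono ?_ hFi.abs.const_smul fun z hz => ?_
  · refine CircleIntegrable.abs ?_
    exact ((hP.sub continuousOn_const).mul hFc).circleIntegrable'
  · rw [abs_of_pos hR] at hz
    simp only [Pi.abs_apply, abs_mul, smul_eq_mul]
    exact mul_le_mul_of_nonneg_right (abs_re_herglotzRieszKernel_sub_one_le hw hρ hR hz)
      (abs_nonneg _)

theorem abs_sub_le_of_harmonicOnNhd {F : ℂ → ℝ} {w z : ℂ} {R ρ : ℝ}
    (hF : InnerProductSpace.HarmonicOnNhd F (closedBall 0 R)) (hw : ‖w‖ ≤ ρ) (hz : ‖z‖ ≤ ρ)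
    (hρ : 2 * ρ ≤ R) (hR : 0 < R) :
    |F w - F z| ≤ 8 * ρ / R * circleAverage (fun z => |F z|) 0 R := by
  have h1 := abs_sub_circleAverage_le_of_harmonicOnNhd hF hw hρ hR
  have h2 := abs_sub_circleAverage_le_of_harmonicOnNhd hF hz hρ hR
  calc |F w - F z| = |(F w - circleAverage F 0 R) - (F z - circleAverage F 0 R)| := by ring_nf
    _ ≤ _ := abs_sub _ _
    _ ≤ _ := add_le_add h1 h2
    _ = _ := by ring

end CircleAverage

/-! ### The quotient `g(qz + c)/g(z)` estimated by the characteristic. -/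

section ValueDistribution

open Real Metric MeromorphicOn ValueDistribution Function Function.locallyFinsuppWithin

/-- A zero or pole `u` with `|u| ≤ R` contributes `log (KR/|u|) ≥ log K` to the integrated count at
radius `KR`. At `u = 0` it contributes `log (KR)`, which is where `1 ≤ R` enters. -/
theorem sum_abs_divisor_mul_log_le (g : ℂ → ℂ) {R K : ℝ} (hR : 1 ≤ R) (hK : 1 ≤ K)
    {s : Finset ℂ} (hs : ∀ u ∈ s, ‖u‖ ≤ R) :
    (∑ u ∈ s, |(divisor g Set.univ u : ℝ)|) * log K
      ≤ ValueDistribution.logCounting g 0 (K * R) + ValueDistribution.logCounting g ⊤ (K * R) := by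
  classical
  set D := divisor g Set.univ with hD
  have hR0 : 0 < R := by linarith
  have hKR : R ≤ K * R := le_mul_of_one_le_left hR0.le hK
  rw [logCounting_zero, logCounting_top, ← Pi.add_apply, ← map_add]
  have hle : ∑ u ∈ s, |D u| • single u (1 : ℤ) ≤ D⁺ + D⁻ := by
    intro z
    have h1 : (∑ u ∈ s, |D u| • single u (1 : ℤ)) z = if z ∈ s then |D z| else 0 := by
      simp [Finset.sum_apply, Pi.single_apply]
    have h2 : (D⁺ + D⁻) z = |D z| := by
      rw [coe_add, Pi.add_apply, posPart_apply, negPart_apply, posPart_add_negPart]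
    rw [h1, h2]
    split_ifs
    · exact le_rfl
    · exact abs_nonneg _
  refine le_trans ?_ (logCounting_le hle (hR.trans hKR))
  rw [map_sum, Finset.sum_apply, Finset.sum_mul]
  refine Finset.sum_le_sum fun u hu => ?_
  rw [map_zsmul, Pi.smul_apply, logCounting_single_eq_log_sub_const ((hs u hu).trans hKR)]
  simp only [Int.cast_one, one_mul, zsmul_eq_mul, Int.cast_abs]
  refine mul_le_mul_of_nonneg_left ?_ (abs_nonneg _)
  rw [log_mul (by linarith) hR0.ne']
  have : log ‖u‖ ≤ log R := by
    rcases eq_or_ne u 0 with rfl | h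
    · simpa using log_nonneg hR
    · exact log_le_log (norm_pos_iff.2 h) (hs u hu)
  linarith

theorem characteristic_inv_le {g : ℂ → ℂ} (hg : Meromorphic g) {R : ℝ} (hR : R ≠ 0) :
    characteristic g⁻¹ ⊤ R
      ≤ characteristic g ⊤ R + |log ‖meromorphicTrailingCoeffAt g 0‖| := by
  have h1 := characteristic_sub_characteristic_inv_of_ne_zero hg hR
  have h2 := neg_abs_le (log ‖meromorphicTrailingCoeffAt g 0‖)
  linarith

theorem logCounting_zero_add_logCounting_top_le {g : ℂ → ℂ} (hg : Meromorphic g) {R : ℝ}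
    (hR : 1 ≤ R) :
    ValueDistribution.logCounting g 0 R + ValueDistribution.logCounting g ⊤ R
      ≤ 2 * characteristic g ⊤ R + |log ‖meromorphicTrailingCoeffAt g 0‖| := by
  have h1 := characteristic_inv_le hg (R := R) (by linarith)
  have h2 : ValueDistribution.logCounting g⁻¹ ⊤ R ≤ characteristic g⁻¹ ⊤ R :=
    le_add_of_nonneg_left (proximity_nonneg R)
  have h3 : ValueDistribution.logCounting g ⊤ R ≤ characteristic g ⊤ R :=
    le_add_of_nonneg_left (proximity_nonneg R)
  rw [logCounting_inv] at h2
  linarith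

theorem circleAverage_abs_log_norm_le {g : ℂ → ℂ} (hg : Meromorphic g) {R : ℝ}
    (hR : 1 ≤ R) :
    circleAverage (fun z => |log ‖g z‖|) 0 R
      ≤ 2 * characteristic g ⊤ R + |log ‖meromorphicTrailingCoeffAt g 0‖| := by
  have h1 := characteristic_inv_le hg (R := R) (by linarith)
  have h2 : proximity g⁻¹ ⊤ R ≤ characteristic g⁻¹ ⊤ R :=
    le_add_of_nonneg_right (logCounting_nonneg hR)
  have h3 : proximity g ⊤ R ≤ characteristic g ⊤ R :=
    le_add_of_nonneg_right (logCounting_nonneg hR)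
  have h4 : circleAverage (fun z => |log ‖g z‖|) 0 R = proximity g ⊤ R + proximity g⁻¹ ⊤ R := by
    rw [proximity_top, proximity_top,
      ← circleAverage_add hg.meromorphicOn.circleIntegrable_posLog_norm
        hg.inv.meromorphicOn.circleIntegrable_posLog_norm]
    congr 1
    ext z
    simp only [Pi.add_apply, Pi.inv_apply, norm_inv, posLog_apply, log_inv]
    rcases abs_cases (log ‖g z‖) with ⟨h, h'⟩ | ⟨h, h'⟩
    · rw [h, max_eq_right h', max_eq_left (by linarith), add_zero]
    · rw [h, max_eq_left h'.le, max_eq_right (by linarith), zero_add]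
  linarith

/-- No exceptional points arise: if `a` or `b` vanishes, the left side is `0` by the convention `x /
0 = 0`. -/
theorem posLog_norm_div_le (a b : ℂ) : log⁺ ‖a / b‖ ≤ |log ‖a‖ - log ‖b‖| := by
  rcases eq_or_ne a 0 with rfl | ha
  · simp
  rcases eq_or_ne b 0 with rfl | hb
  · simp
  rw [norm_div, posLog_apply, log_div (norm_ne_zero_iff.2 ha) (norm_ne_zero_iff.2 hb)]
  exact max_le (abs_nonneg _) (le_abs_self _)

/-- A meromorphic function is, on a closed disc and off a countable set, the product of the linear
factors belonging to its zeros and poles and of a function `h` with `log ‖h‖` harmonic. -/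
theorem exists_harmonicOnNhd_log_norm_eq {g : ℂ → ℂ} (hg : Meromorphic g)
    (hg' : ∀ z, meromorphicOrderAt g z ≠ ⊤) (R : ℝ) :
    ∃ (s : Finset ℂ) (F : ℂ → ℝ) (B : Set ℂ), (∀ u ∈ s, ‖u‖ ≤ R) ∧
      InnerProductSpace.HarmonicOnNhd F (closedBall 0 R) ∧ B.Countable ∧
      ∀ z, ‖z‖ ≤ R → z ∉ B →
        log ‖g z‖ = ∑ u ∈ s, (divisor g Set.univ u : ℝ) * log ‖z - u‖ + F z := by
  have hfin := (divisor g (closedBall 0 R)).finiteSupport (isCompact_closedBall 0 R)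
  obtain ⟨h, h1, h2, h3⟩ := MeromorphicOn.extract_zeros_poles
    (hg.meromorphicOn (s := closedBall 0 R)) (fun u => hg' u) hfin
  have h4 := MeromorphicOn.extract_zeros_poles_log h2 h3
  have hmem (u : ℂ) (hu : u ∈ hfin.toFinset) : u ∈ closedBall (0 : ℂ) R :=
    (divisor g (closedBall 0 R)).supportWithinDomain (hfin.mem_toFinset.1 hu)
  refine ⟨hfin.toFinset, fun z => log ‖h z‖,
    closedBall 0 R \ {z | log ‖g z‖ = (∑ᶠ u, (divisor g (closedBall 0 R) u * log ‖· - u‖)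
      + (log ‖h ·‖)) z}, fun u hu => by simpa using hmem u hu, fun z hz =>
      (h1 z hz).harmonicAt_log_norm (h2 ⟨z, hz⟩), ?_, fun z hz hzB => ?_⟩
  · exact ((isCompact_closedBall (0 : ℂ) R).finite_sdiff_of_mem_codiscreteWithin h4).countable
  · have hz' : z ∈ closedBall (0 : ℂ) R := by simpa using hz
    have h5 : log ‖g z‖ = (∑ᶠ u, (divisor g (closedBall 0 R) u * log ‖· - u‖)
      + (log ‖h ·‖)) z := by
      by_contra hne
      exact hzB ⟨hz', hne⟩
    rw [h5, finsum_eq_sum_of_support_subset (s := hfin.toFinset)]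
    · simp only [Pi.add_apply, Finset.sum_apply, add_left_inj]
      refine Finset.sum_congr rfl fun u hu => ?_
      rw [divisor_apply hg.meromorphicOn (hmem u hu),
        divisor_apply hg.meromorphicOn (Set.mem_univ u)]
    · intro u hu
      rw [Set.Finite.coe_toFinset]
      contrapose! hu
      simp only [Function.mem_support, not_not] at hu ⊢
      ext z
      simp [hu]

/-- Here `n` is the number of zeros and poles in the disc of radius `Kr`, with multiplicity. The
term with `16 / K` comes from the harmonic part, the last one from the linear factors. -/
theorem proximity_comp_affine_div_le {g : ℂ → ℂ} (hg : Meromorphic g)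
    (hg' : ∀ z, meromorphicOrderAt g z ≠ ⊤) {q c : ℂ} (hq0 : 0 < ‖q‖) (hq1 : ‖q‖ ≤ 1)
    {r K : ℝ} (hr : 1 ≤ r) (hc : 2 * ‖c‖ ≤ r) (hK : 4 ≤ K) :
    ∃ n : ℝ, 0 ≤ n ∧ n * log K ≤ 2 * characteristic g ⊤ (K ^ 2 * r)
        + |log ‖meromorphicTrailingCoeffAt g 0‖| ∧
      proximity (fun z => g (q * z + c) / g z) ⊤ r ≤
        16 / K * (2 * characteristic g ⊤ (K * r) + |log ‖meromorphicTrailingCoeffAt g 0‖|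
          + 2 * log 2 * n) + (4 * log 2 + log (2 / ‖q‖)) * n := by
  have hr0 : 0 < r := by linarith
  have hq : q ≠ 0 := norm_pos_iff.1 hq0
  set R := K * r with hRdef
  have hrR : r ≤ R := by nlinarith
  have hR : 1 ≤ R := hr.trans hrR
  have hR0 : 0 < R := by linarith
  obtain ⟨s, F, B, hs, hF, hB, hgF⟩ := exists_harmonicOnNhd_log_norm_eq hg hg' R
  set D : ℂ → ℝ := fun u => (divisor g Set.univ u : ℝ) with hD
  set n := ∑ u ∈ s, |D u| with hn
  refine ⟨n, Finset.sum_nonneg fun _ _ => abs_nonneg _, ?_, ?_⟩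
  · have h1 := sum_abs_divisor_mul_log_le g hR (by linarith : 1 ≤ K) hs
    refine h1.trans ?_
    have e : K ^ 2 * r = K * R := by rw [hRdef]; ring
    rw [e]
    exact logCounting_zero_add_logCounting_top_le hg (by nlinarith)
  -- The added constant turns the linear factors into `log (|z - u|/R)`, whose absolute mean on the
  -- circle of radius `R` is at most `2 log 2`. It cancels in differences of `G`.
  set G : ℂ → ℝ := fun z => F z + (∑ u ∈ s, D u) * log R with hG
  have hGh : InnerProductSpace.HarmonicOnNhd G (closedBall 0 R) := fun z hz =>
    (hF z hz).add (InnerProductSpace.harmonicAt_const _)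
  have hGavg : circleAverage (fun z => |G z|) 0 R ≤ 2 * characteristic g ⊤ R
      + |log ‖meromorphicTrailingCoeffAt g 0‖| + 2 * log 2 * n := by
    have hi1 : CircleIntegrable (fun z => |log ‖g z‖|) 0 R :=
      hg.meromorphicOn.circleIntegrable_log_norm.abs
    have hi2 (u : ℂ) : CircleIntegrable (fun z => |D u| * |log ‖z - u‖ - log R|) 0 R :=
      ((circleIntegrable_log_norm_sub_const R).sub (circleIntegrable_const _ _ _)).abs.const_smul
    have hi3 : CircleIntegrable (fun z => ∑ u ∈ s, |D u| * |log ‖z - u‖ - log R|) 0 R :=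
      CircleIntegrable.fun_sum s fun u _ => hi2 u
    calc circleAverage (fun z => |G z|) 0 R
        ≤ circleAverage (fun z => |log ‖g z‖| + ∑ u ∈ s, |D u| * |log ‖z - u‖ - log R|) 0 R := by
          refine circleAverage_mono_of_countable hR0.ne' hB (fun z => abs_nonneg _) (hi1.add hi3)
            fun z hz hzB => ?_
          have hz' : ‖z‖ ≤ R := by
            rw [abs_of_pos hR0] at hz; exact (mem_sphere_zero_iff_norm.1 hz).le
          have e : G z = log ‖g z‖ - ∑ u ∈ s, D u * (log ‖z - u‖ - log R) := by
            rw [hgF z hz' hzB, hG]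
            simp only [mul_sub, Finset.sum_sub_distrib, Finset.sum_mul]
            ring
          rw [e]
          refine (abs_sub _ _).trans (add_le_add_right ?_ _)
          refine (Finset.abs_sum_le_sum_abs _ _).trans (le_of_eq ?_)
          simp only [abs_mul]
      _ = circleAverage (fun z => |log ‖g z‖|) 0 R
          + ∑ u ∈ s, |D u| * circleAverage (fun z => |log ‖z - u‖ - log R|) 0 R := by
          rw [circleAverage_fun_add hi1 hi3, circleAverage_fun_sum fun u _ => hi2 u]
          congr 1
          refine Finset.sum_congr rfl fun u _ => ?_
          simp only [← smul_eq_mul |D u|]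
          exact circleAverage_fun_smul
      _ ≤ (2 * characteristic g ⊤ R + |log ‖meromorphicTrailingCoeffAt g 0‖|)
          + ∑ u ∈ s, |D u| * (2 * log 2) := by
          refine add_le_add (circleAverage_abs_log_norm_le hg hR) (Finset.sum_le_sum fun u hu => ?_)
          refine mul_le_mul_of_nonneg_left ?_ (abs_nonneg _)
          have := circleAverage_abs_log_norm_sub_sub_log_max_le hR u
          rwa [max_eq_left (hs u hu)] at this
      _ = _ := by rw [← Finset.sum_mul, hn]; ring
  have hi4 (u : ℂ) : CircleIntegrable
      (fun z => |D u| * |log ‖q * z + c - u‖ - log ‖z - u‖|) 0 r :=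
    ((circleIntegrable_log_norm_affine_sub q c u r).sub
      (circleIntegrable_log_norm_sub_const r)).abs.const_smul
  have hi5 : CircleIntegrable
      (fun z => ∑ u ∈ s, |D u| * |log ‖q * z + c - u‖ - log ‖z - u‖|) 0 r :=
    CircleIntegrable.fun_sum s fun u _ => hi4 u
  set M := 16 / K * circleAverage (fun z => |G z|) 0 R with hM
  calc proximity (fun z => g (q * z + c) / g z) ⊤ r
      ≤ circleAverage (fun z => M + ∑ u ∈ s, |D u| * |log ‖q * z + c - u‖ - log ‖z - u‖|) 0 r := by
        rw [proximity_top]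
        refine circleAverage_mono_of_countable (B := B ∪ (fun z => q * z + c) ⁻¹' B) hr0.ne'
          (hB.union (hB.preimage fun a b hab => ?_)) (fun z => posLog_nonneg)
          ((circleIntegrable_const _ _ _).add hi5) fun z hz hzB => ?_
        · simpa [hq] using hab
        rw [Set.mem_union, not_or] at hzB
        rw [abs_of_pos hr0] at hz
        have hzr : ‖z‖ = r := mem_sphere_zero_iff_norm.1 hz
        have hwr : ‖q * z + c‖ ≤ 2 * r := by
          refine (norm_add_le _ _).trans ?_
          rw [norm_mul, hzr]
          nlinarith
        -- The oscillation bound applies with `ρ = 2r`, so `8ρ/R = 16/K`.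
        have h2R : 2 * (2 * r) ≤ R := by rw [hRdef]; nlinarith
        refine (posLog_norm_div_le _ _).trans ?_
        rw [hgF _ (by linarith) hzB.2, hgF _ (by linarith) hzB.1]
        have e : ∑ u ∈ s, D u * log ‖q * z + c - u‖ + F (q * z + c)
            - (∑ u ∈ s, D u * log ‖z - u‖ + F z)
            = (G (q * z + c) - G z)
              + ∑ u ∈ s, D u * (log ‖q * z + c - u‖ - log ‖z - u‖) := by
          simp only [hG, mul_sub, Finset.sum_sub_distrib]
          ring
        rw [e]
        refine (abs_add_le _ _).trans (add_le_add ?_ ?_)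
        · refine (abs_sub_le_of_harmonicOnNhd hGh hwr (by linarith) h2R hR0).trans (le_of_eq ?_)
          rw [hM, hRdef]
          congr 1
          field_simp
          norm_num
        · refine (Finset.abs_sum_le_sum_abs _ _).trans (le_of_eq ?_)
          simp only [abs_mul]
    _ = M + ∑ u ∈ s, |D u| * circleAverage
          (fun z => |log ‖q * z + c - u‖ - log ‖z - u‖|) 0 r := by
        rw [circleAverage_fun_add (circleIntegrable_const _ _ _) hi5, circleAverage_const,
          circleAverage_fun_sum fun u _ => hi4 u]
        congr 1
        refine Finset.sum_congr rfl fun u _ => ?_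
        simp only [← smul_eq_mul |D u|]
        exact circleAverage_fun_smul
    _ ≤ _ := by
        refine add_le_add (mul_le_mul_of_nonneg_left hGavg (by positivity)) ?_
        rw [hn, mul_comm, Finset.sum_mul]
        exact Finset.sum_le_sum fun u _ => mul_le_mul_of_nonneg_left
          (circleAverage_abs_log_norm_affine_sub_sub_log_norm_sub_le hq0 hq1 hr hc u) (abs_nonneg _)

/-- Under the doubling bounds `n ≤ 5T/log K`, and `1/K ≤ 1/log K`. The constant is `260 = 16 · (5 +
10) + 4 · 5`. -/
theorem proximity_comp_affine_div_le_of_le {g : ℂ → ℂ} (hg : Meromorphic g)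
    (hg' : ∀ z, meromorphicOrderAt g z ≠ ⊤) {q c : ℂ} (hq0 : 0 < ‖q‖) (hq1 : ‖q‖ ≤ 1)
    {r K : ℝ} (hr : 1 ≤ r) (hc : 2 * ‖c‖ ≤ r) (hK : 4 ≤ K)
    (h1 : characteristic g ⊤ (K * r) ≤ 2 * characteristic g ⊤ r)
    (h2 : characteristic g ⊤ (K ^ 2 * r) ≤ 2 * characteristic g ⊤ r)
    (h3 : |log ‖meromorphicTrailingCoeffAt g 0‖| ≤ characteristic g ⊤ r) :
    proximity (fun z => g (q * z + c) / g z) ⊤ r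
      ≤ (260 + 5 * log (2 / ‖q‖)) / log K * characteristic g ⊤ r := by
  obtain ⟨n, hn0, hn, hm⟩ := proximity_comp_affine_div_le hg hg' hq0 hq1 hr hc hK
  set T := characteristic g ⊤ r
  have hT : 0 ≤ T := (abs_nonneg _).trans h3
  have hlogK : 1 ≤ log K := by
    rw [le_log_iff_exp_le (by linarith)]
    linarith [exp_one_lt_d9]
  have hlogK' : log K ≤ K := (log_le_sub_one_of_pos (by linarith)).trans (by linarith)
  have hL : 0 ≤ log (2 / ‖q‖) := log_nonneg (by rw [le_div_iff₀ hq0]; linarith)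
  have hl2 : 0 ≤ log 2 := log_nonneg one_le_two
  have hl2' : log 2 ≤ 1 := by linarith [log_two_lt_d9]
  have hn1 : n ≤ 5 * T / log K := by
    rw [le_div_iff₀ (by linarith)]; linarith
  have hn2 : n ≤ 5 * T := hn1.trans (div_le_self (by linarith) hlogK)
  have hK16 : 16 / K ≤ 16 / log K := div_le_div_of_nonneg_left (by norm_num) (by linarith) hlogK'
  calc proximity (fun z => g (q * z + c) / g z) ⊤ r
      ≤ 16 / log K * (5 * T + 10 * T) + (4 + log (2 / ‖q‖)) * (5 * T / log K) := by
        refine hm.trans (add_le_add ?_ ?_)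
        · refine mul_le_mul hK16 ?_ ?_ (by positivity)
          · have : 2 * log 2 * n ≤ 2 * (5 * T) := by nlinarith
            linarith
          · have hT2 : 0 ≤ characteristic g ⊤ (K * r) := characteristic_nonneg (by nlinarith)
            positivity
        · exact mul_le_mul (by linarith) hn1 hn0 (by linarith)
    _ = _ := by
        field_simp
        ring

end ValueDistribution

/-! ### Exceptional sets of logarithmic density zero. -/

section LogDensity

open Real MeasureTheory Set

theorem integrableOn_inv_Icc_one (r : ℝ) : IntegrableOn (fun t : ℝ => t⁻¹) (Icc 1 r) :=
  ContinuousOn.integrableOn_Icc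
    (continuousOn_inv₀.mono fun _ ht => ne_of_gt (lt_of_lt_of_le one_pos ht.1))

theorem setIntegral_inv_inter_Icc_one_mono {A B : Set ℝ} {r : ℝ}
    (hB : MeasurableSet B) (h : A ∩ Icc 1 r ⊆ B) :
    ∫ t in A ∩ Icc 1 r, t⁻¹ ≤ ∫ t in B ∩ Icc 1 r, t⁻¹ := by
  refine setIntegral_mono_set ((integrableOn_inv_Icc_one r).mono_set inter_subset_right) ?_
    (LE.le.eventuallyLE fun t ht => ⟨h ht, ht.2⟩)
  filter_upwards [ae_restrict_mem (hB.inter measurableSet_Icc)] with t ht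
  exact inv_nonneg.2 (zero_le_one.trans ht.2.1)

theorem setIntegral_inv_inter_Icc_one_nonneg {A : Set ℝ} (hA : MeasurableSet A) (r : ℝ) :
    0 ≤ ∫ t in A ∩ Icc 1 r, t⁻¹ :=
  setIntegral_nonneg (hA.inter measurableSet_Icc) fun _ ht => inv_nonneg.2 (zero_le_one.trans ht.2.1)

theorem setIntegral_inv_Icc_one {r : ℝ} (hr : 1 ≤ r) : ∫ t in Icc 1 r, t⁻¹ = log r := by
  rw [integral_Icc_eq_integral_Ioc, ← intervalIntegral.integral_of_le hr,
    integral_inv_of_pos one_pos (by linarith), div_one]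

/-- Off a set of logarithmic density zero, a monotone function of order zero grows by at most
`log 2` when its argument is multiplied by `K`. -/
theorem tendsto_setIntegral_inv_div_log_of_monotone {φ : ℝ → ℝ} (hφ : Monotone φ)
    (hφ0 : ∀ t, 0 ≤ φ t) (hφo : φ =o[atTop] log) {K : ℝ} (hK : 1 ≤ K) :
    Tendsto (fun r => (∫ t in {t | 1 ≤ t ∧ φ t + log 2 < φ (K * t)} ∩ Icc 1 r, t⁻¹) / log r)
      atTop (nhds 0) := by
  have hK0 : 0 < K := by linarith
  have hφK : Monotone fun t => φ (K * t) := hφ.comp (monotone_mul_left_of_nonneg hK0.le)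
  set S := {t | 1 ≤ t ∧ φ t + log 2 < φ (K * t)} with hS
  have hSm : MeasurableSet S := (measurableSet_le measurable_const measurable_id).inter
    (measurableSet_lt (hφ.measurable.add_const _) hφK.measurable)
  have hl2 : 0 < log 2 := log_pos one_lt_two
  have hint {ψ : ℝ → ℝ} (hψ : Monotone ψ) {a b : ℝ} (ha : 0 < a) (hb : 0 < b) :
      IntervalIntegrable (fun t => ψ t * t⁻¹) volume a b := by
    refine (hψ.intervalIntegrable).mul_continuousOn (continuousOn_inv₀.mono fun t ht => ?_)
    exact ne_of_gt (lt_of_lt_of_le (lt_min ha hb) ht.1)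
  have key (r : ℝ) (hr : 1 ≤ r) :
      (∫ t in S ∩ Icc 1 r, t⁻¹) ≤ φ (K * r) * log K / log 2 := by
    have hr0 : 0 < r := by linarith
    have hKr : 0 < K * r := by positivity
    have hrKr : r ≤ K * r := le_mul_of_one_le_left hr0.le hK
    rw [le_div_iff₀ hl2]
    calc (∫ t in S ∩ Icc 1 r, t⁻¹) * log 2
        = ∫ t in S ∩ Icc 1 r, t⁻¹ * log 2 := (integral_mul_const _ _).symm
      _ ≤ ∫ t in S ∩ Icc 1 r, (φ (K * t) * t⁻¹ - φ t * t⁻¹) := by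
          have hi := (hint hφK one_pos hr0).sub (hint hφ one_pos hr0)
          rw [intervalIntegrable_iff_integrableOn_Icc_of_le hr] at hi
          refine setIntegral_mono_on
            (((integrableOn_inv_Icc_one r).mono_set inter_subset_right).mul_const _)
            (hi.mono_set inter_subset_right) (hSm.inter measurableSet_Icc) fun t ht => ?_
          have h1 : 0 ≤ t⁻¹ := inv_nonneg.2 (zero_le_one.trans ht.1.1)
          have h2 := ht.1.2
          nlinarith
      _ ≤ ∫ t in Icc 1 r, (φ (K * t) * t⁻¹ - φ t * t⁻¹) := by
          have hi := (hint hφK one_pos hr0).sub (hint hφ one_pos hr0)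
          rw [intervalIntegrable_iff_integrableOn_Icc_of_le hr] at hi
          refine setIntegral_mono_set hi ?_ (LE.le.eventuallyLE inter_subset_right)
          filter_upwards [ae_restrict_mem measurableSet_Icc] with t ht
          have ht0 : 0 ≤ t := zero_le_one.trans ht.1
          have h3 : φ t ≤ φ (K * t) := hφ (le_mul_of_one_le_left ht0 hK)
          have : 0 ≤ t⁻¹ := inv_nonneg.2 ht0
          simp only [Pi.zero_apply, ← sub_mul]
          exact mul_nonneg (by linarith) this
      _ = (∫ t in (1 : ℝ)..r, φ (K * t) * t⁻¹) - ∫ t in (1 : ℝ)..r, φ t * t⁻¹ := by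
          rw [integral_Icc_eq_integral_Ioc, ← intervalIntegral.integral_of_le hr,
            intervalIntegral.integral_sub (hint hφK one_pos hr0) (hint hφ one_pos hr0)]
      -- As `dt/t` is scale invariant, the substitution `t ↦ Kt` makes the difference of integrals
      -- telescope, leaving essentially the window `[r, Kr]`, where `φ ≤ φ(Kr) = o(log r)`.
      _ = (∫ t in K..(K * r), φ t * t⁻¹) - ∫ t in (1 : ℝ)..r, φ t * t⁻¹ := by
          congr 1
          have := intervalIntegral.smul_integral_comp_mul_left (a := 1) (b := r)
            (fun t => φ t * t⁻¹) K
          rw [mul_one] at this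
          rw [← this, smul_eq_mul, ← intervalIntegral.integral_const_mul]
          refine intervalIntegral.integral_congr fun t _ => ?_
          simp only [mul_inv]
          field_simp
      _ = (∫ t in r..(K * r), φ t * t⁻¹) - ∫ t in (1 : ℝ)..K, φ t * t⁻¹ := by
          have h1 := intervalIntegral.integral_add_adjacent_intervals
            (hint hφ one_pos hK0) (hint hφ hK0 hKr)
          have h2 := intervalIntegral.integral_add_adjacent_intervals
            (hint hφ one_pos hr0) (hint hφ hr0 hKr)
          linarith
      _ ≤ ∫ t in r..(K * r), φ t * t⁻¹ := by
          have : 0 ≤ ∫ t in (1 : ℝ)..K, φ t * t⁻¹ :=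
            intervalIntegral.integral_nonneg hK fun t ht =>
              mul_nonneg (hφ0 t) (inv_nonneg.2 (zero_le_one.trans ht.1))
          linarith
      _ ≤ ∫ t in r..(K * r), φ (K * r) * t⁻¹ := by
          refine intervalIntegral.integral_mono_on hrKr (hint hφ hr0 hKr)
            (hint monotone_const hr0 hKr) fun t ht => ?_
          exact mul_le_mul_of_nonneg_right (hφ ht.2) (inv_nonneg.2 (hr0.le.trans ht.1))
      _ = φ (K * r) * log K := by
          rw [intervalIntegral.integral_const_mul, integral_inv_of_pos hr0 hKr,
            mul_div_cancel_right₀ _ hr0.ne']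
  have hlim : (fun r => φ (K * r) * log K / log 2) =o[atTop] log := by
    have h1 : (fun r => φ (K * r)) =o[atTop] fun r => log (K * r) :=
      hφo.comp_tendsto (tendsto_id.const_mul_atTop hK0)
    have h2 : (fun r => log (K * r)) =O[atTop] log := by
      have h3 : (fun r => log K + log r) =O[atTop] log :=
        (isLittleO_const_log_atTop.isBigO).add (isBigO_refl _ _)
      refine h3.congr' ?_ EventuallyEq.rfl
      filter_upwards [eventually_gt_atTop 0] with r hr
      rw [log_mul hK0.ne' hr.ne']
    have h4 := (h1.trans_isBigO h2).const_mul_left (log K / log 2)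
    refine h4.congr_left fun r => ?_
    ring
  refine squeeze_zero' ?_ ?_ hlim.tendsto_div_nhds_zero
  · filter_upwards [eventually_ge_atTop 1] with r hr
    exact div_nonneg (setIntegral_inv_inter_Icc_one_nonneg hSm r) (log_nonneg hr)
  · filter_upwards [eventually_ge_atTop 1] with r hr
    exact div_le_div_of_nonneg_right (key r hr) (log_nonneg hr)

/-- Diagonal argument: `S n` is switched on only from a radius `a n` beyond which its density is at
most `1/(n + 1)`. -/
theorem exists_measurableSet_tendsto_setIntegral_inv_div_log {S : ℕ → Set ℝ} (hS : Monotone S)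
    (hSm : ∀ n, MeasurableSet (S n))
    (hS0 : ∀ n, Tendsto (fun r => (∫ t in S n ∩ Icc 1 r, t⁻¹) / log r) atTop (nhds 0)) :
    ∃ F : Set ℝ, MeasurableSet F ∧
      Tendsto (fun r => (∫ t in F ∩ Icc 1 r, t⁻¹) / log r) atTop (nhds 0) ∧
      ∀ n, ∀ᶠ t in atTop, t ∉ F → t ∉ S n := by
  have hex (n : ℕ) : ∃ a : ℝ, n ≤ a ∧ ∀ r, a ≤ r →
      (∫ t in S n ∩ Icc 1 r, t⁻¹) / log r ≤ 1 / ((n : ℝ) + 1) := by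
    have h1 : ∀ᶠ r in atTop, (∫ t in S n ∩ Icc 1 r, t⁻¹) / log r ≤ 1 / ((n : ℝ) + 1) :=
      (hS0 n).eventually_le_const (by positivity)
    obtain ⟨a, ha⟩ := eventually_atTop.1 h1
    exact ⟨max n a, le_max_left _ _, fun r hr => ha r ((le_max_right _ _).trans hr)⟩
  choose a ha1 ha2 using hex
  have hFm : MeasurableSet (⋃ n, S n ∩ Ici (a n)) :=
    MeasurableSet.iUnion fun n => (hSm n).inter measurableSet_Ici
  refine ⟨⋃ n, S n ∩ Ici (a n), hFm, ?_, fun n => ?_⟩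
  · rw [Metric.tendsto_atTop]
    intro ε hε
    obtain ⟨n, hn⟩ := exists_nat_one_div_lt hε
    refine ⟨max 1 (a n), fun r hr => ?_⟩
    have hr1 : 1 ≤ r := (le_max_left _ _).trans hr
    have hrn : a n ≤ r := (le_max_right _ _).trans hr
    -- Since `a k ≥ k`, only finitely many sets are active up to `r`; by monotonicity the one with
    -- the largest index `m` contains all of them there.
    have hfin : {k | a k ≤ r}.Finite := (finite_Iic ⌊r⌋₊).subset fun k hk =>
      Nat.le_floor ((ha1 k).trans hk)
    obtain ⟨m, hm, hmax⟩ := hfin.exists_maximal ⟨n, hrn⟩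
    have hmax' (k : ℕ) (hk : a k ≤ r) : k ≤ m := by
      by_contra! h
      exact absurd (hmax hk h.le) (not_le.2 h)
    have hsub : (⋃ n, S n ∩ Ici (a n)) ∩ Icc 1 r ⊆ S m := by
      rintro t ⟨ht, ht2⟩
      obtain ⟨k, hk1, hk2⟩ := mem_iUnion.1 ht
      exact hS (hmax' k (le_trans hk2 ht2.2)) hk1
    have h1 : (∫ t in (⋃ n, S n ∩ Ici (a n)) ∩ Icc 1 r, t⁻¹) / log r ≤ 1 / ((m : ℝ) + 1) :=
      (div_le_div_of_nonneg_right (setIntegral_inv_inter_Icc_one_mono (hSm m) hsub)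
        (log_nonneg hr1)).trans (ha2 m r hm)
    have h2 : 1 / ((m : ℝ) + 1) ≤ 1 / ((n : ℝ) + 1) := by
      have : (n : ℝ) ≤ m := by exact_mod_cast hmax' n hrn
      gcongr
    rw [dist_zero_right, norm_eq_abs, abs_of_nonneg
      (div_nonneg (setIntegral_inv_inter_Icc_one_nonneg hFm r) (log_nonneg hr1))]
    linarith
  · filter_upwards [eventually_ge_atTop (a n)] with t ht htF htS
    exact htF (mem_iUnion.2 ⟨n, htS, ht⟩)

theorem hasLogDensityOne_diff {F : Set ℝ} (hF : MeasurableSet F)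
    (hF0 : Tendsto (fun r => (∫ t in F ∩ Icc 1 r, t⁻¹) / log r) atTop (nhds 0)) :
    HasLogDensityOne (Ioi 0 \ F) := by
  refine ⟨sdiff_subset, measurableSet_Ioi.diff hF, ?_⟩
  have h1 : Tendsto (fun r => 1 - (∫ t in F ∩ Icc 1 r, t⁻¹) / log r) atTop (nhds 1) := by
    simpa using tendsto_const_nhds.sub hF0
  refine h1.congr' ?_
  filter_upwards [eventually_gt_atTop 1] with r hr
  have hlog : log r ≠ 0 := (log_pos hr).ne'
  have e : (Ioi 0 \ F) ∩ Icc 1 r = Icc 1 r \ F := by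
    ext t
    simp only [mem_inter_iff, Set.mem_sdiff, mem_Ioi, mem_Icc]
    exact ⟨fun h => ⟨h.2, h.1.2⟩, fun h => ⟨⟨by linarith [h.1.1], h.2⟩, h.1⟩⟩
  have h2 := integral_inter_add_sdiff hF (integrableOn_inv_Icc_one r)
  rw [setIntegral_inv_Icc_one hr.le, inter_comm] at h2
  rw [e, eq_div_iff hlog, sub_mul, div_mul_cancel₀ _ hlog, one_mul]
  linarith

theorem posLog_nevanlinnaT_isLittleO_log {g : ℂ → ℂ} (hg : growthOrder g = 0) :
    (fun r => posLog (nevanlinnaT g r)) =o[atTop] log := by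
  rw [isLittleO_iff]
  intro ε hε
  have h1 : limsup (fun r : ℝ => ((posLog (nevanlinnaT g r) / log r : ℝ) : EReal)) atTop
      < (ε : EReal) := by
    rw [show limsup (fun r : ℝ => ((posLog (nevanlinnaT g r) / log r : ℝ) : EReal)) atTop = 0
      from hg]
    exact_mod_cast hε
  filter_upwards [eventually_lt_of_limsup_lt h1, eventually_gt_atTop 1] with r hr hr1
  have hlog := log_pos hr1
  rw [EReal.coe_lt_coe_iff, div_lt_iff₀ hlog] at hr
  rw [norm_of_nonneg posLog_nonneg, norm_of_nonneg hlog.le]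
  exact hr.le

theorem exists_hasLogDensityOne_posLog_nevanlinnaT_le {g : ℂ → ℂ} (hg : Meromorphic g)
    (hg0 : growthOrder g = 0) :
    ∃ E, HasLogDensityOne E ∧ ∀ n : ℕ, 1 ≤ n → ∀ᶠ r in atTop ⊓ 𝓟 E,
      posLog (nevanlinnaT g (n * r)) ≤ posLog (nevanlinnaT g r) + log 2 := by
  -- Truncation at `1` gives a function monotone on all of `ℝ`: the characteristic is nonnegative
  -- only for radii at least `1` and monotone only on positive radii.
  set φ : ℝ → ℝ := fun r => posLog (nevanlinnaT g (max r 1)) with hφdef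
  have hφeq {r : ℝ} (hr : 1 ≤ r) : φ r = posLog (nevanlinnaT g r) := by
    simp only [hφdef, max_eq_left hr]
  have hφ : Monotone φ := fun a b hab =>
    posLog_le_posLog (ValueDistribution.characteristic_nonneg (le_max_right _ _))
      (ValueDistribution.characteristic_monotoneOn hg
        (mem_Ioi.2 (lt_of_lt_of_le one_pos (le_max_right _ _)))
        (mem_Ioi.2 (lt_of_lt_of_le one_pos (le_max_right _ _))) (max_le_max_right 1 hab))
  have hφo : φ =o[atTop] log := by
    refine (posLog_nevanlinnaT_isLittleO_log hg0).congr' ?_ EventuallyEq.rfl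
    filter_upwards [eventually_ge_atTop 1] with r hr
    exact (hφeq hr).symm
  set S : ℕ → Set ℝ := fun n => {t | 1 ≤ t ∧ φ t + log 2 < φ (((n : ℝ) + 1) * t)} with hS
  have hSmono : Monotone S := fun m n hmn t ht => by
    refine ⟨ht.1, ht.2.trans_le (hφ ?_)⟩
    have : (m : ℝ) ≤ n := by exact_mod_cast hmn
    have := ht.1
    gcongr
  have hSm (n : ℕ) : MeasurableSet (S n) :=
    (measurableSet_le measurable_const measurable_id).inter
      (measurableSet_lt (hφ.measurable.add_const _)
        (hφ.comp (monotone_mul_left_of_nonneg (by positivity))).measurable)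
  obtain ⟨F, hFm, hF0, hF⟩ := exists_measurableSet_tendsto_setIntegral_inv_div_log hSmono hSm
    fun n => tendsto_setIntegral_inv_div_log_of_monotone hφ (fun _ => posLog_nonneg) hφo
      (by linarith [n.cast_nonneg (α := ℝ)])
  refine ⟨Ioi 0 \ F, hasLogDensityOne_diff hFm hF0, fun n hn => ?_⟩
  rw [eventually_inf_principal]
  filter_upwards [hF (n - 1), eventually_ge_atTop 1] with r hr hr1 hrE
  have h1 : ((n - 1 : ℕ) : ℝ) + 1 = n := by
    rw [Nat.cast_sub hn]; simp
  have hn' : (1 : ℝ) ≤ n := by exact_mod_cast hn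
  have h2 := hr hrE.2
  simp only [hS, mem_ofPred_eq, not_and, not_lt, h1] at h2
  have h3 := h2 hr1
  rwa [hφeq hr1, hφeq (by nlinarith)] at h3

end LogDensity

/-! ### From affine quotients to iterated Hahn differences. -/

section Hahn

open Real Metric MeromorphicOn ValueDistribution Function Function.locallyFinsuppWithin Topology

theorem meromorphicOrderAt_sub_const_ne_top {g : ℂ → ℂ} (hg : Meromorphic g)
    (hg' : ¬ IsConstantMeromorphic g) (a z : ℂ) :
    meromorphicOrderAt (fun w => g w - a) z ≠ ⊤ := by
  have hf : Meromorphic fun w => g w - a := fun w => (hg w).sub (MeromorphicAt.const a w)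
  refine hf.exists_meromorphicOrderAt_ne_top_iff_forall.1 ?_ z
  -- By the identity principle infinite order at one point spreads to all points. Where the function
  -- is in normal form, infinite order forces the value `0`, so `g = a` off a discrete set.
  by_contra! h
  refine hg' ⟨a, ?_⟩
  filter_upwards [(hf.meromorphicOn (s := Set.univ)).meromorphicNFAt_mem_codiscreteWithin] with w hw
  have h0 := mt hw.meromorphicOrderAt_eq_zero_iff.2
  simp only [h w, WithTop.top_ne_zero, not_false_eq_true, true_implies, not_not] at h0
  by_contra hne
  have := hw.meromorphicOrderAt_eq_zero_iff.2 (sub_ne_zero.2 hne)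
  simp [h w] at this

theorem meromorphicOrderAt_ne_top_of_not_isConstantMeromorphic {g : ℂ → ℂ} (hg : Meromorphic g)
    (hg' : ¬ IsConstantMeromorphic g) (z : ℂ) : meromorphicOrderAt g z ≠ ⊤ := by
  simpa using meromorphicOrderAt_sub_const_ne_top hg hg' 0 z

/-- Subtracting a value `g z₀` taken at a point of analyticity creates a zero, so `N(r, 1/(g - g
z₀)) ≥ log r - log |z₀|`; the first main theorem carries this growth to `T(r, g)`. -/
theorem tendsto_nevanlinnaT_atTop {g : ℂ → ℂ} (hg : Meromorphic g)
    (hg' : ¬ IsConstantMeromorphic g) : Tendsto (nevanlinnaT g) atTop atTop := by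
  obtain ⟨z₀, hz₀⟩ := (hg 0).eventually_analyticAt.exists
  set f : ℂ → ℂ := fun w => g w - g z₀ with hf
  have hfm : Meromorphic f := fun w => (hg w).sub (MeromorphicAt.const _ w)
  have hpos : 0 < meromorphicOrderAt f z₀ := by
    rw [← tendsto_zero_iff_meromorphicOrderAt_pos (hfm z₀)]
    have h1 : ContinuousAt f z₀ := hz₀.continuousAt.sub continuousAt_const
    have h2 : Tendsto f (𝓝 z₀) (𝓝 0) := by simpa [hf] using h1.tendsto
    exact h2.mono_left nhdsWithin_le_nhds
  have hne : meromorphicOrderAt f z₀ ≠ ⊤ := meromorphicOrderAt_sub_const_ne_top hg hg' _ _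
  have hD : 1 ≤ divisor f Set.univ z₀ := by
    rw [divisor_apply hfm.meromorphicOn (Set.mem_univ _)]
    lift meromorphicOrderAt f z₀ to ℤ using hne with m
    simpa using Int.add_one_le_iff.2 (show (0 : ℤ) < m by exact_mod_cast hpos)
  have hle : single z₀ (1 : ℤ) ≤ (divisor f Set.univ)⁺ := by
    intro z
    rw [posPart_apply]
    rcases eq_or_ne z z₀ with rfl | h
    · simpa using hD.trans (le_posPart _)
    · simp [h, posPart_nonneg]
  have hbound : ∀ᶠ r in atTop, log r - (log ‖z₀‖ + (log⁺ ‖g z₀‖ + log 2)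
      + |log ‖meromorphicTrailingCoeffAt f 0‖|) ≤ nevanlinnaT g r := by
    filter_upwards [eventually_ge_atTop 1, eventually_ge_atTop ‖z₀‖] with r hr hr'
    have h1 := logCounting_le hle hr
    rw [logCounting_single_eq_log_sub_const hr', ← logCounting_zero, ← logCounting_inv,
      Int.cast_one, one_mul] at h1
    have h2 : ValueDistribution.logCounting f⁻¹ ⊤ r ≤ characteristic f⁻¹ ⊤ r :=
      le_add_of_nonneg_left (proximity_nonneg r)
    have h3 := characteristic_inv_le hfm (R := r) (by linarith)
    have h4 := (abs_le.1 (abs_characteristic_sub_characteristic_shift_le (a₀ := g z₀) (r := r) hg)).1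
    change _ ≤ characteristic g ⊤ r
    change _ ≤ characteristic g ⊤ r - characteristic f ⊤ r at h4
    linarith
  exact tendsto_atTop_mono' _ hbound (tendsto_atTop_add_const_right _ _ tendsto_log_atTop)

theorem nevanlinnaM_comp_affine_div_isLittleO {g : ℂ → ℂ} (hg : Meromorphic g)
    (hg' : ¬ IsConstantMeromorphic g) {E : Set ℝ}
    (hE : ∀ n : ℕ, 1 ≤ n → ∀ᶠ r in atTop ⊓ 𝓟 E,
      posLog (nevanlinnaT g (n * r)) ≤ posLog (nevanlinnaT g r) + log 2)
    {q c : ℂ} (hq0 : 0 < ‖q‖) (hq1 : ‖q‖ ≤ 1) :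
    (fun r => nevanlinnaM (fun z => g (q * z + c) / g z) r) =o[atTop ⊓ 𝓟 E] nevanlinnaT g := by
  have hT {p : ℝ → Prop} (h : ∀ᶠ r in atTop, p r) : ∀ᶠ r in atTop ⊓ 𝓟 E, p r :=
    h.filter_mono inf_le_left
  have hE' (n : ℕ) (hn : 1 ≤ n) : ∀ᶠ r in atTop ⊓ 𝓟 E,
      nevanlinnaT g (n * r) ≤ 2 * nevanlinnaT g r := by
    filter_upwards [hE n hn, hT ((tendsto_nevanlinnaT_atTop hg hg').eventually_ge_atTop 1)]
      with r h1 h2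
    -- Once `T(r) ≥ 1`, the additive `log 2` for `log⁺ T` becomes a factor `2` for `T`; if `T(nr) ≤
    -- 1` the bound is immediate.
    rcases le_total (nevanlinnaT g (n * r)) 1 with h3 | h3
    · linarith
    · rw [posLog_eq_log (h3.trans (le_abs_self _)), posLog_eq_log (h2.trans (le_abs_self _)),
        add_comm, ← log_mul two_ne_zero (by linarith)] at h1
      exact (log_le_log_iff (by linarith) (by linarith)).1 h1
  rw [isLittleO_iff]
  intro ε hε
  have hlim : Tendsto (fun n : ℕ => (260 + 5 * log (2 / ‖q‖)) / log n) atTop (𝓝 0) :=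
    tendsto_const_nhds.div_atTop (tendsto_log_atTop.comp tendsto_natCast_atTop_atTop)
  obtain ⟨n, hn, hn4⟩ := ((hlim.eventually_le_const hε).and (eventually_ge_atTop 4)).exists
  have hn4' : (4 : ℝ) ≤ n := by exact_mod_cast hn4
  filter_upwards [hE' n (by omega), hE' (n ^ 2) (Nat.one_le_pow _ _ (by omega)),
    hT ((tendsto_nevanlinnaT_atTop hg hg').eventually_ge_atTop
      |log ‖meromorphicTrailingCoeffAt g 0‖|), hT (eventually_ge_atTop 1),
    hT (eventually_ge_atTop (2 * ‖c‖))] with r h1 h2 h3 hr hc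
  rw [Nat.cast_pow] at h2
  have h4 := proximity_comp_affine_div_le_of_le hg
    (meromorphicOrderAt_ne_top_of_not_isConstantMeromorphic hg hg') hq0 hq1 hr hc hn4' h1 h2 h3
  have hT0 : 0 ≤ nevanlinnaT g r := characteristic_nonneg hr
  rw [norm_of_nonneg (proximity_nonneg r), norm_of_nonneg hT0]
  exact h4.trans (mul_le_mul_of_nonneg_right hn hT0)

theorem iterate_affine_apply (q c : ℂ) (j : ℕ) (z : ℂ) :
    (fun w => q * w + c)^[j] z = q ^ j * z + c * ∑ i ∈ Finset.range j, q ^ i := by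
  induction j with
  | zero => simp
  | succ j ih =>
    have h : ∑ i ∈ Finset.range (j + 1), q ^ i = q * ∑ i ∈ Finset.range j, q ^ i + 1 := by
      rw [Finset.sum_range_succ', Finset.mul_sum]
      simp only [pow_succ', pow_zero]
    rw [iterate_succ_apply', ih, h]
    ring

theorem tendsto_affine_cobounded {a : ℂ} (ha : a ≠ 0) (b : ℂ) :
    Tendsto (fun z => a * z + b) (Bornology.cobounded ℂ) (Bornology.cobounded ℂ) := by
  rw [← tendsto_norm_atTop_iff_cobounded]
  refine tendsto_atTop_mono (f := fun z => ‖a‖ * ‖z‖ - ‖b‖) (fun z => ?_) ?_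
  · have := norm_sub_norm_le (a * z) (-b)
    rwa [norm_mul, norm_neg, sub_neg_eq_add] at this
  · exact tendsto_atTop_add_const_right _ _
      (tendsto_norm_cobounded_atTop.const_mul_atTop (norm_pos_iff.2 ha))

/-- Near infinity `|(q - 1)z + c| ≥ 1` because `q ≠ 1`, so the division only helps and each step at
most doubles the constant. `q ≠ 0` keeps `qz + c` near infinity, where the induction hypothesis
applies. -/
theorem eventually_norm_iteratedHahnDifference_le {q : ℂ} (hq0 : q ≠ 0) (hq1 : q ≠ 1) (c : ℂ)
    (g : ℂ → ℂ) (k : ℕ) :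
    ∀ᶠ z in Bornology.cobounded ℂ, ‖iteratedHahnDifference q c k g z‖
      ≤ 2 ^ k * ∑ j ∈ Finset.range (k + 1), ‖g ((fun w => q * w + c)^[j] z)‖ := by
  induction k with
  | zero => simp [iteratedHahnDifference]
  | succ k ih =>
    have h1 := (tendsto_affine_cobounded hq0 c).eventually ih
    have h2 := (tendsto_norm_cobounded_atTop.comp
      (tendsto_affine_cobounded (sub_ne_zero.2 hq1) c)).eventually_ge_atTop 1
    filter_upwards [ih, h1, h2] with z hz hz1 hz2
    rw [iteratedHahnDifference, hahnDifference, norm_div]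
    refine (div_le_self (norm_nonneg _) hz2).trans ((norm_sub_le _ _).trans
      ((add_le_add hz1 hz).trans ?_))
    simp only [← iterate_succ_apply]
    have e1 := Finset.sum_range_succ' (fun j => ‖g ((fun w => q * w + c)^[j] z)‖) (k + 1)
    have e2 := Finset.sum_range_succ (fun j => ‖g ((fun w => q * w + c)^[j] z)‖) (k + 1)
    have n1 := norm_nonneg (g ((fun w => q * w + c)^[0] z))
    have n2 := norm_nonneg (g ((fun w => q * w + c)^[k + 1] z))
    rw [pow_succ, mul_assoc, two_mul, mul_add]
    refine add_le_add (mul_le_mul_of_nonneg_left ?_ (by positivity))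
      (mul_le_mul_of_nonneg_left ?_ (by positivity)) <;> linarith

theorem meromorphic_comp_affine {g : ℂ → ℂ} (hg : Meromorphic g) (q c : ℂ) :
    Meromorphic fun z => g (q * z + c) := fun z => by
  refine (hg (q * z + c)).comp_analyticAt (g := fun z => q * z + c) (by fun_prop)

theorem eventually_nevanlinnaM_iteratedHahnDifference_div_le {g : ℂ → ℂ} (hg : Meromorphic g)
    {q : ℂ} (hq0 : q ≠ 0) (hq1 : q ≠ 1) (c : ℂ) (k : ℕ) :
    ∀ᶠ r in atTop, nevanlinnaM (fun z => iteratedHahnDifference q c k g z / g z) r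
      ≤ (log⁺ (2 ^ k) + log (k + 1)) + ∑ j ∈ Finset.range (k + 1),
        nevanlinnaM (fun z => g (q ^ j * z + c * ∑ i ∈ Finset.range j, q ^ i) / g z) r := by
  have h := eventually_norm_iteratedHahnDifference_le hq0 hq1 c g k
  rw [← comap_norm_atTop, eventually_comap] at h
  filter_upwards [h, eventually_gt_atTop 0] with r hr hr0
  have hi (j : ℕ) : CircleIntegrable
      (fun z => log⁺ ‖g (q ^ j * z + c * ∑ i ∈ Finset.range j, q ^ i) / g z‖) 0 r :=
    MeromorphicOn.circleIntegrable_posLog_norm fun z _ =>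
      (meromorphic_comp_affine hg (q ^ j) _ z).div (hg z)
  have hi2 := CircleIntegrable.fun_sum (Finset.range (k + 1)) fun j _ => hi j
  simp only [nevanlinnaM, proximity_top]
  rw [← circleAverage_fun_sum fun j _ => hi j, ← circleAverage_const (log⁺ (2 ^ k) + log (k + 1)) 0 r,
    ← circleAverage_fun_add (circleIntegrable_const _ _ _) hi2]
  refine circleAverage_mono_of_countable hr0.ne' Set.countable_empty (fun z => posLog_nonneg)
    ((circleIntegrable_const _ _ _).add hi2) fun z hz _ => ?_
  rw [abs_of_pos hr0, mem_sphere_zero_iff_norm] at hz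
  have h1 := hr z hz
  simp only [iterate_affine_apply] at h1
  have h2 : ‖iteratedHahnDifference q c k g z / g z‖ ≤ 2 ^ k * ∑ j ∈ Finset.range (k + 1),
      ‖g (q ^ j * z + c * ∑ i ∈ Finset.range j, q ^ i) / g z‖ := by
    simp only [norm_div, ← Finset.sum_div, ← mul_div_assoc]
    exact div_le_div_of_nonneg_right h1 (norm_nonneg _)
  refine (posLog_le_posLog (norm_nonneg _) h2).trans (posLog_mul.trans ?_)
  have h3 := posLog_sum (Finset.range (k + 1))
    fun j => ‖g (q ^ j * z + c * ∑ i ∈ Finset.range j, q ^ i) / g z‖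
  rw [Finset.card_range] at h3
  push_cast at h3
  linarith

end Hahn

theorem mainTheorem2 (g : ℂ → ℂ) (hg : Meromorphic g) (hg_nonconst : ¬ IsConstantMeromorphic g)
    (hg_order : growthOrder g = 0) (q c : ℂ) (hq_pos : 0 < ‖q‖) (hq_lt : ‖q‖ < 1) :
    ∃ E : Set ℝ, HasLogDensityOne E ∧
      (fun r : ℝ => nevanlinnaM (fun z => hahnDifference q c g z / g z) r)
        =o[atTop ⊓ 𝓟 E] (fun r : ℝ => nevanlinnaT g r) ∧
      ∀ k : ℕ, 1 ≤ k →
        (fun r : ℝ => nevanlinnaM (fun z => iteratedHahnDifference q c k g z / g z) r)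
          =o[atTop ⊓ 𝓟 E] (fun r : ℝ => nevanlinnaT g r) := by
  obtain ⟨E, hE, hE'⟩ := exists_hasLogDensityOne_posLog_nevanlinnaT_le hg hg_order
  have hq0 : q ≠ 0 := norm_pos_iff.1 hq_pos
  have hq1 : q ≠ 1 := fun h => by simp [h] at hq_lt
  have key (k : ℕ) : (fun r : ℝ => nevanlinnaM (fun z => iteratedHahnDifference q c k g z / g z) r)
      =o[atTop ⊓ 𝓟 E] (fun r : ℝ => nevanlinnaT g r) := by
    have hconst : (fun _ : ℝ => Real.posLog (2 ^ k) + Real.log (k + 1))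
        =o[atTop ⊓ 𝓟 E] (nevanlinnaT g) :=
      (isLittleO_const_left.2 (Or.inr (tendsto_norm_atTop_atTop.comp
        (tendsto_nevanlinnaT_atTop hg hg_nonconst)))).mono inf_le_left
    have hsum : (fun r => ∑ j ∈ Finset.range (k + 1), nevanlinnaM
        (fun z => g (q ^ j * z + c * ∑ i ∈ Finset.range j, q ^ i) / g z) r)
        =o[atTop ⊓ 𝓟 E] (nevanlinnaT g) :=
      -- The multiplier `q^j` equals `1` for `j = 0`, hence the affine estimate is needed for
      -- modulus `≤ 1`. The same `E` serves every `j` and `k`, as it was chosen from `g` alone.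
      IsLittleO.fun_sum fun j _ => nevanlinnaM_comp_affine_div_isLittleO hg hg_nonconst hE'
        (by rw [norm_pow]; positivity) (by rw [norm_pow]; exact pow_le_one₀ hq_pos.le hq_lt.le)
    refine IsBigO.trans_isLittleO (IsBigO.of_bound' ?_) (hconst.add hsum)
    filter_upwards [(eventually_nevanlinnaM_iteratedHahnDifference_div_le hg hq0 hq1 c k).filter_mono
      (inf_le_left : atTop ⊓ 𝓟 E ≤ atTop)] with r hr
    rw [Real.norm_of_nonneg (ValueDistribution.proximity_nonneg r)]
    exact hr.trans (le_abs_self _)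
  exact ⟨E, hE, key 1, fun k _ => key k⟩
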